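/- Let $(J,\overline{\phantom{A}})$ be a finite convex geometry, i.e. a finite set $J$ with a closure operator $A\mapsto\overline{A}$ on its subsets satisfying the anti-exchange axiom: if $A=\overline A$, $x\ne y$, $x\notin A$ and $x\in\overline{A\cup\{y\}}$, then $y\notin\overline{A\cup\{x\}}$. Call a set $D\subseteq J$ dependent if $x\in\overline{D\setminus\{x\}}$ for some $x\in D$, and call the inclusion-minimal dependent sets circuits. Suppose that $(J,\overline{\phantom{A}})$ is a convex $4$-geometry, i.e. every circuit has exactly four elements. A realization of $(J,\overline{\phantom{A}})$ is an injective map $f:J\to\mathbb{R}^2$ such that no three distinct points of $f(J)$ are collinear and $f(\overline{A})=\operatorname{conv}(f(A))\cap f(J)$ for all $A\subseteq J$. Suppose that $(J,\overline{\phantom{A}})$ is realizable, i.e. has a realization. Let $L=\{x\in J: x\notin\overline{J\setminus\{x\}}\}$ be its outside layer, and suppose that there is exactly one inner point, i.e. $|J\setminus L|=1$. Let $J[3]$ be the set of triples of pairwise distinct elements of $J$. A realization $f$ induces the order type $t_f:J[3]\to\{1,-1\}$, where $t_f(a,b,c)=1$ if $f(a),f(b),f(c)$ are in anticlockwise order and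 $t_f(a,b,c)=-1$ otherwise. Two order types $t_1,t_2$ on $J$ are equivalent if there is a bijection $\delta:J\to J$ with $t_2(a,b,c)=t_1(\delta(a),\delta(b),\delta(c))$ for all $(a,b,c)\in J[3]$. Then the set of equivalence classes of the order types $t_f$, where $f$ ranges over all realizations of $(J,\overline{\phantom{A}})$, has at most two elements. -/

import Mathlib

/-- A convex geometry on `J`: a closure operator on the subsets of `J` which satisfies the
anti-exchange axiom. -/
structure ConvexGeometry (J : Type*) where
  cl : ClosureOperator (Set J)
  antiExchange : ∀ (A : Set J) (x y : J), cl A = A → x ≠ y →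
    x ∈ cl (A ∪ {y}) → x ∉ A → y ∉ cl (A ∪ {x})

namespace ConvexGeometry

variable {J : Type*} (G : ConvexGeometry J)

/-- A set is dependent if one of its elements lies in the closure of the others. -/
def IsDependent (D : Set J) : Prop := ∃ x ∈ D, x ∈ G.cl (D \ {x})

/-- A circuit is an inclusion-minimal dependent set. -/
def IsCircuit (C : Set J) : Prop := Minimal G.IsDependent C

/-- A convex geometry is a convex 4-geometry if all its circuits have exactly four elements. -/
def IsFourGeometry : Prop := ∀ C : Set J, G.IsCircuit C → C.ncard = 4

/-- The outermost layer: the set of extreme points of the geometry. -/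
def outsideLayer : Set J := {x | x ∉ G.cl (Set.univ \ {x})}

end ConvexGeometry

/-- The plane. -/
abbrev Plane : Type := EuclideanSpace ℝ (Fin 2)

/-- The orientation of a triple of points of the plane: `1` if `x, y, z` is anticlockwise and `-1`
if it is clockwise. It is used for noncollinear triples only. -/
noncomputable def orientationSign (x y z : Plane) : ℤˣ :=
  if 0 < (y 0 - x 0) * (z 1 - x 1) - (y 1 - x 1) * (z 0 - x 0) then 1 else -1

/-- `J[3]`: the set of all triples `(a, b, c)` of pairwise distinct elements of `J`; the entries of
`e` are `e 0`, `e 1`, `e 2`. -/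
abbrev Triples (J : Type*) : Type _ := Fin 3 ↪ J

/-- No triple of distinct labels is mapped to three collinear points. -/
def InGeneralPosition {J : Type*} (f : J → Plane) : Prop :=
  ∀ e : Triples J, ¬ Collinear ℝ {f (e 0), f (e 1), f (e 2)}

/-- The function `J[3] → {1, -1}` that records the orientations of the triples of `f`. -/
noncomputable def orientationMap {J : Type*} (f : J → Plane) (e : Triples J) : ℤˣ :=
  orientationSign (f (e 0)) (f (e 1)) (f (e 2))

/-- The order types on `J`: the functions `J[3] → {1, -1}` which are induced by some point
configuration in general position, labelled by `J`. -/
def PlanarOrderType (J : Type*) : Type _ :=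
  {t : Triples J → ℤˣ // ∃ f : J → Plane, InGeneralPosition f ∧ t = orientationMap f}

/-- Two order types on `J` are equivalent if a bijection of `J` onto itself carries one to the
other. -/
def PlanarOrderType.Equivalent {J : Type*} (t₁ t₂ : PlanarOrderType J) : Prop :=
  ∃ δ : Equiv.Perm J, ∀ e : Triples J, t₂.1 e = t₁.1 (e.trans δ.toEmbedding)

/-- Equivalence of order types as an equivalence relation. -/
def PlanarOrderType.setoid (J : Type*) : Setoid (PlanarOrderType J) where
  r := PlanarOrderType.Equivalent
  iseqv :=
    { refl := fun _ => ⟨Equiv.refl J, fun _ => rfl⟩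
      symm := by
        rintro t₁ t₂ ⟨δ, h⟩
        refine ⟨δ.symm, fun e => ?_⟩
        have he : (e.trans δ.symm.toEmbedding).trans δ.toEmbedding = e := by
          ext i
          simp
        rw [h, he]
      trans := by
        rintro t₁ t₂ t₃ ⟨δ, h⟩ ⟨ε, h'⟩
        refine ⟨ε.trans δ, fun e => ?_⟩
        rw [h', h]
        rfl }

namespace ConvexGeometry

variable {J : Type*} (G : ConvexGeometry J)

/-- `f` is a realization of `G`: it is a bijection of `J` onto a set of points of the plane in
general position, and it carries the closure operator of `G` to the closure operator
`Y ↦ convexHull Y ∩ X` on the set of points `X = f(J)`. -/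
structure IsRealization (f : J → Plane) : Prop where
  injective : Function.Injective f
  generalPosition : InGeneralPosition f
  image_cl : ∀ A : Set J, f '' G.cl A = convexHull ℝ (f '' A) ∩ Set.range f

/-- `G` is realizable if it is isomorphic to the convex geometry of some set of points of the
plane in general position. -/
def IsRealizable : Prop := ∃ f : J → Plane, G.IsRealization f

/-- The set of all order types which are induced by the realizations of `G`. -/
def orderTypes : Set (PlanarOrderType J) :=
  {t | ∃ f : J → Plane, G.IsRealization f ∧ t.1 = orientationMap f}

/-- The set of equivalence classes of the order types of the realizations of `G`. -/
def orderTypeClasses : Set (Quotient (PlanarOrderType.setoid J)) :=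
  Quotient.mk (PlanarOrderType.setoid J) '' G.orderTypes

end ConvexGeometry

/-! Let `p` be the inner point. A realization makes the other points a tournament: `a → b` if `p, a,
b` is anticlockwise. This tournament is locally transitive, and its directed 3-cycles are the
triangles containing `p`, which the closure operator determines (`cyclic_iff`). By
`exists_equiv_or_reverse`, a finite locally transitive tournament is fixed by its unoriented
3-cycles up to isomorphism and reversal: all cycles are kept or all reversed, and points in no
common cycle can be permuted freely. As every other point is extreme, the tournament gives back the
orientation of each triple (`planeDet_pos_iff`). Any two realizations thus have equal or opposite
order types up to relabelling, which leaves at most two classes. -/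

/-! ### Locally transitive tournaments and their cyclic triangles -/

/-- `a → b → c → a` is a directed cycle of `R`. -/
def IsCyclicTriple {L : Type*} (R : L → L → Prop) (a b c : L) : Prop := R a b ∧ R b c ∧ R c a

/-- A tournament in which neither an in-neighbourhood nor an out-neighbourhood contains a
directed 3-cycle. -/
structure IsLocallyTransitiveTournament {L : Type*} (R : L → L → Prop) : Prop where
  irrefl : ∀ a, ¬ R a a
  total : ∀ a b, a ≠ b → (R a b ↔ ¬ R b a)
  out_acyclic : ∀ y a b c, R y a → R y b → R y c → ¬ IsCyclicTriple R a b c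
  in_acyclic : ∀ y a b c, R a y → R b y → R c y → ¬ IsCyclicTriple R a b c

/-- Two relations have the same directed 3-cycles up to orientation. -/
def SameTriangles {L : Type*} (R S : L → L → Prop) : Prop :=
  ∀ a b c, (IsCyclicTriple R a b c ∨ IsCyclicTriple R a c b) ↔
    (IsCyclicTriple S a b c ∨ IsCyclicTriple S a c b)

/-- `x` and `y` lie in a common directed 3-cycle. -/
def Linked {L : Type*} (R : L → L → Prop) (x y : L) : Prop :=
  ∃ z, IsCyclicTriple R x y z ∨ IsCyclicTriple R x z y

namespace IsCyclicTriple

variable {L : Type*} {R : L → L → Prop} {a b c : L}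

theorem rotate (h : IsCyclicTriple R a b c) : IsCyclicTriple R b c a := ⟨h.2.1, h.2.2, h.1⟩

theorem flip_iff : IsCyclicTriple (flip R) a b c ↔ IsCyclicTriple R a c b := by
  unfold IsCyclicTriple flip
  tauto

end IsCyclicTriple

theorem SameTriangles.flip_right {L : Type*} {R S : L → L → Prop} (h : SameTriangles R S) :
    SameTriangles R (flip S) := fun a b c => by
  rw [h a b c, IsCyclicTriple.flip_iff, IsCyclicTriple.flip_iff, or_comm]

theorem SameTriangles.linked_iff {L : Type*} {R S : L → L → Prop} (h : SameTriangles R S)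
    (x y : L) : Linked R x y ↔ Linked S x y :=
  exists_congr fun z => h x y z

namespace IsLocallyTransitiveTournament

variable {L : Type*} {R S : L → L → Prop}

theorem asymm (hR : IsLocallyTransitiveTournament R) {a b : L} (h : R a b) : ¬ R b a := by
  rcases eq_or_ne a b with rfl | hab
  · exact hR.irrefl a
  · exact (hR.total a b hab).1 h

theorem ne (hR : IsLocallyTransitiveTournament R) {a b : L} (h : R a b) : a ≠ b := by
  rintro rfl
  exact hR.irrefl a h

theorem of_not (hR : IsLocallyTransitiveTournament R) {a b : L} (hab : a ≠ b) (h : ¬ R a b) :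
    R b a := by
  by_contra h'
  exact h ((hR.total a b hab).2 h')

theorem flip (hR : IsLocallyTransitiveTournament R) : IsLocallyTransitiveTournament (flip R) where
  irrefl := hR.irrefl
  total a b hab := hR.total b a hab.symm
  out_acyclic y a b c ha hb hc h :=
    hR.in_acyclic y a c b ha hc hb (IsCyclicTriple.flip_iff.1 h)
  in_acyclic y a b c ha hb hc h :=
    hR.out_acyclic y a c b ha hc hb (IsCyclicTriple.flip_iff.1 h)

theorem edge_iff_next_edge (hS : IsLocallyTransitiveTournament S) (hRS : SameTriangles R S)
    {a b c : L} (h : IsCyclicTriple R a b c) : S a b ↔ S b c := by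
  rcases (hRS a b c).1 (Or.inl h) with ⟨h1, h2, h3⟩ | ⟨h1, h2, h3⟩
  · exact iff_of_true h1 h2
  · exact iff_of_false (hS.asymm h3) (hS.asymm h2)

/-- Cyclic triangles with a common vertex are both kept or both reversed. -/
theorem edge_iff_of_common_vertex (hR : IsLocallyTransitiveTournament R)
    (hS : IsLocallyTransitiveTournament S) (hRS : SameTriangles R S) {x u v w z : L}
    (h : IsCyclicTriple R x u v) (h' : IsCyclicTriple R x w z) : S x u ↔ S x w := by
  have key := fun {a b c : L} => hS.edge_iff_next_edge hRS (a := a) (b := b) (c := c)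
  obtain ⟨xu, uv, vx⟩ := h
  obtain ⟨xw, wz, zx⟩ := h'
  have hxuv : S x u ↔ S u v := key ⟨xu, uv, vx⟩
  have hxuv' : S u v ↔ S v x := key ⟨uv, vx, xu⟩
  have hxwz : S x w ↔ S w z := key ⟨xw, wz, zx⟩
  have hxwz' : S w z ↔ S z x := key ⟨wz, zx, xw⟩
  -- If `u → z`, then `x u z` is a cyclic triangle sharing an edge with each of the two given ones;
  -- `x w v` plays this role if `w → v`.
  by_cases uz : R u z
  · have h1 : S x u ↔ S u z := key ⟨xu, uz, zx⟩
    have h2 : S u z ↔ S z x := key ⟨uz, zx, xu⟩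
    tauto
  by_cases wv : R w v
  · have h1 : S x w ↔ S w v := key ⟨xw, wv, vx⟩
    have h2 : S w v ↔ S v x := key ⟨wv, vx, xw⟩
    tauto
  have zu : R z u := hR.of_not (fun e => hR.asymm xu (e ▸ zx)) uz
  have vw : R v w := hR.of_not (fun e => hR.asymm xw (e ▸ vx)) wv
  rcases eq_or_ne u w with rfl | huw
  · rfl
  -- In the remaining case an out-neighbourhood contains a cycle: that of `z` contains `x u v` if `z
  -- → v`, and that of `v` contains `x w z` if `v → z`.
  have vz : R v z := by
    by_contra h
    refine hR.out_acyclic z x u v zx zu (hR.of_not ?_ h) ⟨xu, uv, vx⟩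
    rintro rfl
    exact uz uv
  exact absurd ⟨xw, wz, zx⟩ (hR.out_acyclic v x w z vx vw vz)

/-- By local transitivity `y` has both in- and out-neighbours on the triangle, so some edge `d → e`
of it has `y → d` and `e → y`. Thus any vertex is joined to any cyclic triangle by two triangles
sharing an edge. -/
theorem exists_edge_of_vertex (hR : IsLocallyTransitiveTournament R) {a b c : L}
    (h : IsCyclicTriple R a b c) (y : L) :
    (∃ d e, IsCyclicTriple R a d e ∧ IsCyclicTriple R y d e) ∨
    (∃ d e, IsCyclicTriple R b d e ∧ IsCyclicTriple R y d e) ∨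
    (∃ d e, IsCyclicTriple R c d e ∧ IsCyclicTriple R y d e) := by
  rcases eq_or_ne y a with rfl | ya
  · exact Or.inl ⟨b, c, h, h⟩
  rcases eq_or_ne y b with rfl | yb
  · exact Or.inr (Or.inl ⟨c, a, h.rotate, h.rotate⟩)
  rcases eq_or_ne y c with rfl | yc
  · exact Or.inr (Or.inr ⟨a, b, h.rotate.rotate, h.rotate.rotate⟩)
  have o := fun h1 h2 h3 => hR.out_acyclic y a b c h1 h2 h3 h
  have i := fun h1 h2 h3 => hR.in_acyclic y a b c h1 h2 h3 h
  have ta := hR.total y a ya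
  have tb := hR.total y b yb
  have tc := hR.total y c yc
  by_cases ha : R y a <;> by_cases hb : R y b <;> by_cases hc : R y c
  · exact absurd hc (fun hc => o ha hb hc)
  · exact Or.inl ⟨b, c, h, hb, h.2.1, by tauto⟩
  · exact Or.inr (Or.inr ⟨a, b, h.rotate.rotate, ha, h.1, by tauto⟩)
  · exact Or.inr (Or.inr ⟨a, b, h.rotate.rotate, ha, h.1, by tauto⟩)
  · exact Or.inr (Or.inl ⟨c, a, h.rotate, hc, h.2.2, by tauto⟩)
  · exact Or.inl ⟨b, c, h, hb, h.2.1, by tauto⟩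
  · exact Or.inr (Or.inl ⟨c, a, h.rotate, hc, h.2.2, by tauto⟩)
  · exact absurd (i (by tauto) (by tauto)) (by tauto)

/-- A tournament with the same cyclic triangles keeps all of them or reverses all of them. -/
theorem edge_iff_edge (hR : IsLocallyTransitiveTournament R)
    (hS : IsLocallyTransitiveTournament S) (hRS : SameTriangles R S) {a b c x y z : L}
    (h : IsCyclicTriple R a b c) (h' : IsCyclicTriple R x y z) : S a b ↔ S x y := by
  have aux : ∀ {a b c : L}, IsCyclicTriple R a b c →
      (∃ d e, IsCyclicTriple R a d e ∧ IsCyclicTriple R x d e) → (S a b ↔ S x y) := by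
    rintro a b c h ⟨d, e, h1, h2⟩
    rw [hR.edge_iff_of_common_vertex hS hRS h h1, hS.edge_iff_next_edge hRS h1,
      ← hS.edge_iff_next_edge hRS h2, hR.edge_iff_of_common_vertex hS hRS h2 h']
  rcases hR.exists_edge_of_vertex h x with h1 | h1 | h1
  · exact aux h h1
  · rw [hS.edge_iff_next_edge hRS h]
    exact aux h.rotate h1
  · rw [hS.edge_iff_next_edge hRS h, hS.edge_iff_next_edge hRS h.rotate]
    exact aux h.rotate.rotate h1

theorem edge_iff_of_linked (hR : IsLocallyTransitiveTournament R)
    (hS : IsLocallyTransitiveTournament S)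
    (h : ∀ a b c, IsCyclicTriple R a b c → S a b) {x y : L} (hxy : Linked R x y) :
    R x y ↔ S x y := by
  obtain ⟨z, hz | hz⟩ := hxy
  · exact iff_of_true hz.1 (h _ _ _ hz)
  · exact iff_of_false (hR.asymm hz.2.2) (hS.asymm (h _ _ _ hz.rotate.rotate))

/-- One reversed triangle forces all of them to be reversed, by `edge_iff_edge`. Every linked pair
is an edge of a triangle. -/
theorem agree_or_reverse (hR : IsLocallyTransitiveTournament R)
    (hS : IsLocallyTransitiveTournament S) (hRS : SameTriangles R S) :
    (∀ x y, Linked R x y → (R x y ↔ S x y)) ∨ (∀ x y, Linked R x y → (R x y ↔ S y x)) := by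
  by_cases h : ∀ a b c, IsCyclicTriple R a b c → S a b
  · exact Or.inl fun x y => hR.edge_iff_of_linked hS h
  · right
    push Not at h
    obtain ⟨a, b, c, habc, hab⟩ := h
    refine fun x y => hR.edge_iff_of_linked hS.flip fun u v w huvw => ?_
    refine hS.of_not (hR.ne huvw.1) ?_
    rwa [hR.edge_iff_edge hS hRS huvw habc]

/-! ### Twin classes and the reconstruction of the tournament -/

theorem not_linked_self (hR : IsLocallyTransitiveTournament R) (x : L) : ¬ Linked R x x := by
  rintro ⟨z, hz | hz⟩
  · exact hR.irrefl x hz.1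
  · exact hR.irrefl x hz.2.2

theorem _root_.Linked.symm {x y : L} (h : Linked R x y) : Linked R y x := by
  obtain ⟨z, hz | hz⟩ := h
  · exact ⟨z, Or.inr hz.rotate⟩
  · exact ⟨z, Or.inl hz.rotate.rotate⟩

/-- Points which lie in no common cyclic triangle have the same edges to all points which are
linked with one of them. -/
theorem edge_iff_of_not_linked (hR : IsLocallyTransitiveTournament R) {x y z : L}
    (hxy : ¬ Linked R x y) (hxz : Linked R x z) : R x z ↔ R y z := by
  have hyz : y ≠ z := fun e => hxy (e ▸ hxz)
  have no1 : ∀ w, ¬ IsCyclicTriple R x y w := fun w h => hxy ⟨w, Or.inl h⟩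
  have no2 : ∀ w, ¬ IsCyclicTriple R x w y := fun w h => hxy ⟨w, Or.inr h⟩
  rcases eq_or_ne x y with rfl | hne
  · rfl
  obtain ⟨w, hw⟩ := hxz
  have hyw : y ≠ w := by
    rintro rfl
    exact hxy ⟨z, hw.symm⟩
  rcases hw with hw | hw
  · refine iff_of_true hw.1 ?_
    by_contra h
    have hzy := hR.of_not hyz h
    -- Either `x → y`, and the cycle `x z w` lies in the in-neighbourhood of `y`, or `y → x` closes
    -- the cycle `x z y`.
    by_cases xy : R x y
    · exact hR.in_acyclic y x z w xy hzy
        (hR.of_not hyw fun h' => no1 w ⟨xy, h', hw.2.2⟩) hw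
    · exact no2 z ⟨hw.1, hzy, hR.of_not hne xy⟩
  · refine iff_of_false (hR.asymm hw.2.2) fun h => ?_
    by_cases xy : R x y
    · exact no1 z ⟨xy, h, hw.2.2⟩
    · have yx := hR.of_not hne xy
      exact hR.out_acyclic y x w z yx
        (hR.of_not hyw.symm fun h' => no2 w ⟨hw.1, h', yx⟩) h hw

theorem edge_iff_of_not_linked' (hR : IsLocallyTransitiveTournament R) {x y z : L}
    (hxy : ¬ Linked R x y) (hxz : Linked R x z) : R z x ↔ R z y := by
  have hyz : y ≠ z := fun e => hxy (e ▸ hxz)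
  have hne : x ≠ z := fun e => hR.not_linked_self x (by rwa [← e] at hxz)
  rw [hR.total z x hne.symm, hR.total z y hyz.symm, hR.edge_iff_of_not_linked hxy hxz]

/-- Replacing `x` by `y` in a triangle through `x` and `z` preserves its edges. This gives the
transitivity of `twins`. -/
theorem linked_of_not_linked (hR : IsLocallyTransitiveTournament R) {x y z : L}
    (hxy : ¬ Linked R x y) (hxz : Linked R x z) : Linked R y z := by
  obtain ⟨w, hw⟩ := id hxz
  have hxw : Linked R x w := ⟨z, hw.symm⟩
  refine ⟨w, ?_⟩
  simpa only [IsCyclicTriple, ← hR.edge_iff_of_not_linked hxy hxz,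
    ← hR.edge_iff_of_not_linked hxy hxw, ← hR.edge_iff_of_not_linked' hxy hxz,
    ← hR.edge_iff_of_not_linked' hxy hxw] using hw

/-- The equivalence relation of lying in no common cyclic triangle. -/
def twins (hR : IsLocallyTransitiveTournament R) : Setoid L where
  r x y := ¬ Linked R x y
  iseqv :=
    { refl := hR.not_linked_self
      symm := fun h h' => h h'.symm
      trans := fun h h' h'' => h' (hR.linked_of_not_linked h h'') }

theorem isStrictTotalOrder_of_not_linked (hR : IsLocallyTransitiveTournament R) {s : L → Prop}
    (hs : ∀ x y, s x → s y → ¬ Linked R x y) :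
    IsStrictTotalOrder {x // s x} (fun a b => R a b) where
  trichotomous a b hab hba := by
    by_contra h
    exact hba (hR.of_not (fun e => h (Subtype.ext e)) hab)
  irrefl a := hR.irrefl a
  trans a b c hab hbc := by
    by_contra h
    have hac : (a : L) ≠ c := fun e => hR.asymm hab (e ▸ hbc)
    exact hs a b a.2 b.2 ⟨c, Or.inl ⟨hab, hbc, hR.of_not hac h⟩⟩

theorem _root_.nonempty_relIso_of_finite {α : Type*} [Finite α] (r s : α → α → Prop)
    [IsStrictTotalOrder α r] [IsStrictTotalOrder α s] : Nonempty (r ≃r s) := by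
  have := Fintype.ofFinite α
  have : IsWellOrder α r := { wf := Finite.wellFounded_of_trans_of_irrefl r }
  have : IsWellOrder α s := { wf := Finite.wellFounded_of_trans_of_irrefl s }
  rw [← Ordinal.type_eq, Ordinal.type_fintype, Ordinal.type_fintype]

/-- `R` and `S` have the same twin classes and order each class totally, perhaps differently; `σ`
carries one order to the other within each class. Edges between classes depend on the classes only,
and there `R` and `S` agree. -/
theorem exists_equiv_of_agree [Finite L] (hR : IsLocallyTransitiveTournament R)
    (hS : IsLocallyTransitiveTournament S) (hRS : SameTriangles R S)
    (h : ∀ x y, Linked R x y → (R x y ↔ S x y)) :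
    ∃ σ : Equiv.Perm L, ∀ x y, R x y ↔ S (σ x) (σ y) := by
  let q : L → Quotient hR.twins := Quotient.mk _
  have hq : ∀ {x y}, q x = q y ↔ ¬ Linked R x y := fun {x y} => Quotient.eq
  have iso : ∀ c : Quotient hR.twins, Nonempty
      ((fun a b : {x // q x = c} => R a b) ≃r (fun a b : {x // q x = c} => S a b)) := by
    intro c
    have hc : ∀ x y, q x = c → q y = c → ¬ Linked R x y := fun x y hx hy =>
      hq.1 (hx.trans hy.symm)
    have := hR.isStrictTotalOrder_of_not_linked hc
    have := hS.isStrictTotalOrder_of_not_linked (s := fun x => q x = c)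
      (fun x y hx hy => (hRS.linked_iff x y).not.1 (hc x y hx hy))
    exact nonempty_relIso_of_finite _ _
  let e := fun c => (iso c).some
  let σ : Equiv.Perm L := Equiv.ofFiberEquiv (f := q) (g := q) fun c => (e c).toEquiv
  have hσ : ∀ c x (hx : q x = c), σ x = e c ⟨x, hx⟩ := by
    rintro c x rfl
    rfl
  have hqσ : ∀ x, ¬ Linked R x (σ x) := fun x => by
    rw [hσ _ x rfl]
    exact hq.1 (e (q x) ⟨x, rfl⟩).2.symm
  refine ⟨σ, fun x y => ?_⟩
  by_cases hxy : Linked R x y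
  · have h1 := hR.linked_of_not_linked (hqσ x) hxy
    have h2 := hR.linked_of_not_linked (hqσ y) h1.symm
    rw [hR.edge_iff_of_not_linked (hqσ x) hxy, hR.edge_iff_of_not_linked' (hqσ y) h1.symm,
      h _ _ h2.symm]
  · rw [hσ (q x) x rfl, hσ (q x) y (hq.2 hxy).symm]
    exact ((e (q x)).map_rel_iff (a := ⟨x, rfl⟩) (b := ⟨y, (hq.2 hxy).symm⟩)).symm

/-- A finite locally transitive tournament is determined by its cyclic triangles up to
isomorphism and reversal. -/
theorem exists_equiv_or_reverse [Finite L] (hR : IsLocallyTransitiveTournament R)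
    (hS : IsLocallyTransitiveTournament S) (hRS : SameTriangles R S) :
    ∃ σ : Equiv.Perm L, (∀ x y, R x y ↔ S (σ x) (σ y)) ∨ (∀ x y, R x y ↔ S (σ y) (σ x)) := by
  rcases hR.agree_or_reverse hS hRS with h | h
  · exact (hR.exists_equiv_of_agree hS hRS h).imp fun σ => Or.inl
  · exact (hR.exists_equiv_of_agree hS.flip hRS.flip_right h).imp fun σ => Or.inr

end IsLocallyTransitiveTournament

/-! ### Signed areas and triangles in the plane -/

/-- Twice the signed area of the triangle `x y z`. -/
def planeDet (x y z : Plane) : ℝ :=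
  (y 0 - x 0) * (z 1 - x 1) - (y 1 - x 1) * (z 0 - x 0)

theorem planeDet_rotate (x y z : Plane) : planeDet y z x = planeDet x y z := by
  unfold planeDet
  ring

theorem planeDet_swap (x y z : Plane) : planeDet x z y = -planeDet x y z := by
  unfold planeDet
  ring

theorem planeDet_add (p x y z : Plane) :
    planeDet x y z = planeDet p x y + planeDet p y z + planeDet p z x := by
  unfold planeDet
  ring

/-- The three-term Grassmann–Plücker relation: if `x y z` were a cycle around `p` inside an in- or
out-neighbourhood of `w`, the three products would have the same strict sign. -/
theorem planeDet_relation (p x y z w : Plane) :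
    planeDet p x y * planeDet p w z + planeDet p y z * planeDet p w x +
      planeDet p z x * planeDet p w y = 0 := by
  unfold planeDet
  ring

theorem collinear_of_planeDet_eq_zero {x y z : Plane} (h : planeDet x y z = 0) :
    Collinear ℝ {x, y, z} := by
  rw [collinear_iff_of_mem (p₀ := x) (by simp)]
  unfold planeDet at h
  by_cases h0 : y 0 - x 0 = 0
  · by_cases h1 : y 1 - x 1 = 0
    · refine ⟨z - x, ?_⟩
      rintro p (rfl | rfl | rfl)
      · exact ⟨0, by simp⟩
      · refine ⟨0, ?_⟩
        ext i
        fin_cases i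
        · simpa using sub_eq_zero.1 h0
        · simpa using sub_eq_zero.1 h1
      · exact ⟨1, by simp⟩
    · refine ⟨y - x, ?_⟩
      rintro p (rfl | rfl | rfl)
      · exact ⟨0, by simp⟩
      · exact ⟨1, by simp⟩
      · refine ⟨(p 1 - x 1) / (y 1 - x 1), ?_⟩
        ext i
        fin_cases i
        · simp only [Fin.zero_eta, vadd_eq_add, PiLp.add_apply, PiLp.smul_apply, PiLp.sub_apply,
            smul_eq_mul]
          field_simp
          linarith
        · simp only [Fin.mk_one, vadd_eq_add, PiLp.add_apply, PiLp.smul_apply, PiLp.sub_apply,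
            smul_eq_mul]
          field_simp
          ring
  · refine ⟨y - x, ?_⟩
    rintro p (rfl | rfl | rfl)
    · exact ⟨0, by simp⟩
    · exact ⟨1, by simp⟩
    · refine ⟨(p 0 - x 0) / (y 0 - x 0), ?_⟩
      ext i
      fin_cases i
      · simp only [Fin.zero_eta, vadd_eq_add, PiLp.add_apply, PiLp.smul_apply, PiLp.sub_apply,
          smul_eq_mul]
        field_simp
        ring
      · simp only [Fin.mk_one, vadd_eq_add, PiLp.add_apply, PiLp.smul_apply, PiLp.sub_apply,
          smul_eq_mul]
        field_simp
        linarith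

theorem mem_convexHull_triple {p x y z : Plane} :
    p ∈ convexHull ℝ {x, y, z} ↔ ∃ a b c : ℝ, 0 ≤ a ∧ 0 ≤ b ∧ 0 ≤ c ∧ a + b + c = 1 ∧
      ∀ i, p i = a * x i + b * y i + c * z i := by
  constructor
  · intro h
    rw [convexHull_insert (by simp), convexHull_pair] at h
    simp only [mem_convexJoin, Set.mem_singleton_iff, exists_eq_left] at h
    obtain ⟨w, ⟨s, t, hs, ht, hst, rfl⟩, ⟨u, v, hu, hv, huv, rfl⟩⟩ := h
    refine ⟨u, v * s, v * t, hu, by positivity, by positivity, ?_, fun i => ?_⟩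
    · rw [add_assoc, ← mul_add, hst, mul_one, huv]
    · simp only [PiLp.add_apply, PiLp.smul_apply, smul_eq_mul]
      ring
  · rintro ⟨a, b, c, ha, hb, hc, habc, h⟩
    have hp : p = a • x + b • y + c • z := by
      ext i
      simpa using h i
    rw [hp]
    have hconv := convex_convexHull ℝ ({x, y, z} : Set Plane)
    have hsub := subset_convexHull ℝ ({x, y, z} : Set Plane)
    have := hconv.sum_mem (t := Finset.univ) (w := ![a, b, c]) (z := ![x, y, z])
      (fun i _ => by fin_cases i <;> simpa)
      (by simpa [Fin.sum_univ_three] using habc)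
      (fun i _ => by fin_cases i <;> exact hsub (by simp))
    simpa [Fin.sum_univ_three] using this

/-- The barycentric coordinates of `p` are the ratios of the signed areas. -/
theorem mem_convexHull_of_planeDet_pos {p x y z : Plane} (hx : 0 ≤ planeDet p y z)
    (hy : 0 ≤ planeDet p z x) (hz : 0 ≤ planeDet p x y) (h : 0 < planeDet x y z) :
    p ∈ convexHull ℝ {x, y, z} := by
  refine mem_convexHull_triple.2 ⟨planeDet p y z / planeDet x y z, planeDet p z x / planeDet x y z,
    planeDet p x y / planeDet x y z, div_nonneg hx h.le, div_nonneg hy h.le, div_nonneg hz h.le,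
    ?_, ?_⟩
  · have := planeDet_add p x y z
    field_simp
    linarith
  · have key : ∀ i, planeDet x y z * p i =
        planeDet p y z * x i + planeDet p z x * y i + planeDet p x y * z i := by
      intro i
      fin_cases i <;> simp only [planeDet, Fin.zero_eta, Fin.mk_one] <;> ring
    intro i
    field_simp
    rw [mul_comm, key]

theorem planeDet_of_mem_convexHull {p x y z : Plane} (h : p ∈ convexHull ℝ {x, y, z}) :
    ∃ a b c : ℝ, 0 ≤ a ∧ 0 ≤ b ∧ 0 ≤ c ∧ planeDet p y z = a * planeDet x y z ∧
      planeDet p z x = b * planeDet x y z ∧ planeDet p x y = c * planeDet x y z := by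
  obtain ⟨a, b, c, ha, hb, hc, habc, hp⟩ := mem_convexHull_triple.1 h
  obtain rfl : a = 1 - b - c := by linarith
  refine ⟨_, b, c, ha, hb, hc, ?_, ?_, ?_⟩ <;>
  · simp only [planeDet, hp]
    ring

theorem InGeneralPosition.planeDet_ne_zero {J : Type*} {f : J → Plane} (hf : InGeneralPosition f)
    {a b c : J} (hab : a ≠ b) (hbc : b ≠ c) (hca : c ≠ a) :
    planeDet (f a) (f b) (f c) ≠ 0 := by
  intro h
  have hinj : Function.Injective ![a, b, c] := by
    intro i j hij
    fin_cases i <;> fin_cases j <;> simp_all [eq_comm]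
  exact hf ⟨![a, b, c], hinj⟩ (collinear_of_planeDet_eq_zero h)

/-! ### The tournament around the inner point -/

/-- `b` comes after `a` in the anticlockwise order seen from `p`. -/
def edgeAround {J : Type*} (f : J → Plane) (p : J) (a b : {x // x ≠ p}) : Prop :=
  0 < planeDet (f p) (f a) (f b)

theorem edgeAround_isLocallyTransitiveTournament {J : Type*} {f : J → Plane}
    (hf : InGeneralPosition f) (p : J) : IsLocallyTransitiveTournament (edgeAround f p) where
  irrefl a h := by
    unfold edgeAround planeDet at h
    linarith
  total a b hab := by
    have := hf.planeDet_ne_zero a.2.symm (Subtype.coe_ne_coe.2 hab) b.2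
    have := planeDet_swap (f p) (f a) (f b)
    unfold edgeAround
    grind
  out_acyclic y a b c ha hb hc h := by
    obtain ⟨h1, h2, h3⟩ := h
    unfold edgeAround at *
    have := planeDet_relation (f p) (f a) (f b) (f c) (f y)
    have := mul_pos h1 hc
    have := mul_pos h2 ha
    have := mul_pos h3 hb
    linarith
  in_acyclic y a b c ha hb hc h := by
    obtain ⟨h1, h2, h3⟩ := h
    unfold edgeAround at *
    have := planeDet_relation (f p) (f a) (f b) (f c) (f y)
    simp only [planeDet_swap (f p) _ (f y)] at this
    have := mul_pos h1 hc
    have := mul_pos h2 ha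
    have := mul_pos h3 hb
    linarith

namespace ConvexGeometry.IsRealization

variable {J : Type*} {G : ConvexGeometry J} {f g : J → Plane} {p : J}

theorem mem_cl_iff (hf : G.IsRealization f) (x : J) (A : Set J) :
    x ∈ G.cl A ↔ f x ∈ convexHull ℝ (f '' A) := by
  rw [← hf.injective.mem_set_image (s := G.cl A), hf.image_cl]
  simp

/-- The right-hand side does not mention `f`, so all realizations share their cyclic triangles. -/
theorem cyclic_iff (hf : G.IsRealization f) (a b c : {x // x ≠ p}) :
    (IsCyclicTriple (edgeAround f p) a b c ∨ IsCyclicTriple (edgeAround f p) a c b) ↔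
      a ≠ b ∧ b ≠ c ∧ c ≠ a ∧ p ∈ G.cl {(a : J), (b : J), (c : J)} := by
  have hT := edgeAround_isLocallyTransitiveTournament hf.generalPosition p
  rw [hf.mem_cl_iff, Set.image_insert_eq, Set.image_pair]
  constructor
  · rintro (h | h)
    · refine ⟨hT.ne h.1, hT.ne h.2.1, hT.ne h.2.2, ?_⟩
      obtain ⟨h1, h2, h3⟩ := h
      unfold edgeAround at *
      refine mem_convexHull_of_planeDet_pos h2.le h3.le h1.le ?_
      rw [planeDet_add (f p)]
      positivity
    · refine ⟨(hT.ne h.2.2).symm, (hT.ne h.2.1).symm, (hT.ne h.1).symm, ?_⟩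
      obtain ⟨h1, h2, h3⟩ := h
      unfold edgeAround at *
      rw [Set.pair_comm]
      refine mem_convexHull_of_planeDet_pos h2.le h3.le h1.le ?_
      rw [planeDet_add (f p)]
      positivity
  · rintro ⟨hab, hbc, hca, h⟩
    obtain ⟨u, v, w, hu, hv, hw, h1, h2, h3⟩ := planeDet_of_mem_convexHull h
    have n1 := hf.generalPosition.planeDet_ne_zero b.2.symm (Subtype.coe_ne_coe.2 hbc) c.2
    have n2 := hf.generalPosition.planeDet_ne_zero c.2.symm (Subtype.coe_ne_coe.2 hca) a.2
    have n3 := hf.generalPosition.planeDet_ne_zero a.2.symm (Subtype.coe_ne_coe.2 hab) b.2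
    have n4 := hf.generalPosition.planeDet_ne_zero (Subtype.coe_ne_coe.2 hab)
      (Subtype.coe_ne_coe.2 hbc) (Subtype.coe_ne_coe.2 hca)
    rcases n4.lt_or_gt with hneg | hpos
    · right
      unfold IsCyclicTriple edgeAround
      rw [planeDet_swap _ (f c) (f a), planeDet_swap _ (f b) (f c), planeDet_swap _ (f a) (f b)]
      refine ⟨neg_pos.2 (n2.lt_of_le ?_), neg_pos.2 (n1.lt_of_le ?_), neg_pos.2 (n3.lt_of_le ?_)⟩
      · exact h2 ▸ mul_nonpos_of_nonneg_of_nonpos hv hneg.le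
      · exact h1 ▸ mul_nonpos_of_nonneg_of_nonpos hu hneg.le
      · exact h3 ▸ mul_nonpos_of_nonneg_of_nonpos hw hneg.le
    · left
      refine ⟨n3.symm.lt_of_le ?_, n1.symm.lt_of_le ?_, n2.symm.lt_of_le ?_⟩
      · exact h3 ▸ mul_nonneg hw hpos.le
      · exact h1 ▸ mul_nonneg hu hpos.le
      · exact h2 ▸ mul_nonneg hv hpos.le

theorem sameTriangles (hf : G.IsRealization f) (hg : G.IsRealization g) :
    SameTriangles (edgeAround f p) (edgeAround g p) := fun a b c => by
  rw [hf.cyclic_iff, hg.cyclic_iff]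

/-- If all points but `p` are extreme, a chain of two edges around `p` is a left turn. -/
theorem planeDet_pos_of_chain (hf : G.IsRealization f) (hp : ∀ x, x ≠ p → x ∈ G.outsideLayer)
    {a b c : {x // x ≠ p}} (hca : c ≠ a) (hab : edgeAround f p a b) (hbc : edgeAround f p b c) :
    0 < planeDet (f a) (f b) (f c) := by
  have hT := edgeAround_isLocallyTransitiveTournament hf.generalPosition p
  have hab' := Subtype.coe_ne_coe.2 (hT.ne hab)
  have hbc' := Subtype.coe_ne_coe.2 (hT.ne hbc)
  have n := hf.generalPosition.planeDet_ne_zero hab' hbc' (Subtype.coe_ne_coe.2 hca)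
  unfold edgeAround at hab hbc
  -- Otherwise `b` lies in the triangle `p a c` and is not extreme.
  refine n.symm.lt_of_le (not_lt.1 fun hneg => hp b b.2 ?_)
  have hsum := planeDet_add (f p) (f a) (f b) (f c)
  have s1 := planeDet_swap (f p) (f a) (f c)
  have r1 := planeDet_rotate (f p) (f a) (f b)
  have r2 := planeDet_rotate (f p) (f b) (f c)
  have r3 := planeDet_rotate (f a) (f b) (f p)
  have r4 := planeDet_rotate (f a) (f b) (f c)
  have s3 := planeDet_swap (f b) (f c) (f a)
  have hb : b.1 ∈ G.cl {p, (a : J), (c : J)} := by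
    rw [hf.mem_cl_iff, Set.image_insert_eq, Set.image_pair]
    refine mem_convexHull_of_planeDet_pos ?_ ?_ ?_ ?_ <;> linarith
  refine G.cl.monotone ?_ hb
  rintro x (rfl | rfl | rfl)
  · exact ⟨trivial, b.2.symm⟩
  · exact ⟨trivial, hab'⟩
  · exact ⟨trivial, hbc'.symm⟩

/-- The orientation of a triple of extreme points is the majority of the orientations of its
edges around `p`. -/
theorem planeDet_pos_iff (hf : G.IsRealization f) (hp : ∀ x, x ≠ p → x ∈ G.outsideLayer)
    {a b c : {x // x ≠ p}} (hab : a ≠ b) (hbc : b ≠ c) (hca : c ≠ a) :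
    0 < planeDet (f a) (f b) (f c) ↔
      (edgeAround f p a b ∧ edgeAround f p b c) ∨ (edgeAround f p b c ∧ edgeAround f p c a) ∨
      (edgeAround f p c a ∧ edgeAround f p a b) := by
  have hT := edgeAround_isLocallyTransitiveTournament hf.generalPosition p
  have pos : ∀ {a b c : {x // x ≠ p}}, a ≠ b → b ≠ c → c ≠ a →
      ((edgeAround f p a b ∧ edgeAround f p b c) ∨ (edgeAround f p b c ∧ edgeAround f p c a) ∨
      (edgeAround f p c a ∧ edgeAround f p a b)) → 0 < planeDet (f a) (f b) (f c) := by
    rintro a b c hab hbc hca (h | h | h)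
    · exact hf.planeDet_pos_of_chain hp hca h.1 h.2
    · rw [← planeDet_rotate]
      exact hf.planeDet_pos_of_chain hp hab h.1 h.2
    · rw [← planeDet_rotate, ← planeDet_rotate]
      exact hf.planeDet_pos_of_chain hp hbc h.1 h.2
  refine ⟨fun h => ?_, pos hab hbc hca⟩
  by_contra hmaj
  have hneg := pos (a := a) (b := c) (c := b) hca.symm hbc.symm hab.symm (by
    have := hT.total a b hab
    have := hT.total b c hbc
    have := hT.total c a hca
    tauto)
  rw [planeDet_swap] at hneg
  linarith

/-- An isomorphism of the tournaments around `p` is an isomorphism of the order types. -/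
theorem planeDet_pos_iff_of_iso (hf : G.IsRealization f) (hg : G.IsRealization g)
    (hp : ∀ x, x ≠ p → x ∈ G.outsideLayer) {δ : Equiv.Perm J} (hδp : δ p = p)
    (hδ : ∀ a b, a ≠ p → b ≠ p → (0 < planeDet (f p) (f a) (f b) ↔
      0 < planeDet (g p) (g (δ a)) (g (δ b)))) {a b c : J} (hab : a ≠ b) (hbc : b ≠ c)
    (hca : c ≠ a) :
    0 < planeDet (f a) (f b) (f c) ↔ 0 < planeDet (g (δ a)) (g (δ b)) (g (δ c)) := by
  by_cases ha : a = p
  · subst ha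
    rw [hδ b c hab.symm hca, hδp]
  by_cases hb : b = p
  · subst hb
    rw [← planeDet_rotate, ← planeDet_rotate (g (δ a)), hδ c a hbc.symm hab, hδp]
  by_cases hc : c = p
  · subst hc
    rw [planeDet_rotate (f c), planeDet_rotate (g (δ c)), hδ a b hca.symm hbc, hδp]
  have hne : ∀ x, x ≠ p → δ x ≠ p := fun x hx h => hx (δ.injective (h.trans hδp.symm))
  have h1 := hf.planeDet_pos_iff hp (a := ⟨a, ha⟩) (b := ⟨b, hb⟩) (c := ⟨c, hc⟩)
    (by simpa) (by simpa) (by simpa)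
  have h2 := hg.planeDet_pos_iff hp (a := ⟨δ a, hne a ha⟩) (b := ⟨δ b, hne b hb⟩)
    (c := ⟨δ c, hne c hc⟩) (by simpa) (by simpa) (by simpa)
  simp only [edgeAround, hδ a b ha hb, hδ b c hb hc, hδ c a hc ha] at h1 h2
  rw [h1, h2]

/-- A reversal of the tournaments around `p` is a reversal of the order types. -/
theorem planeDet_pos_iff_of_reverse (hf : G.IsRealization f) (hg : G.IsRealization g)
    (hp : ∀ x, x ≠ p → x ∈ G.outsideLayer) {δ : Equiv.Perm J} (hδp : δ p = p)
    (hδ : ∀ a b, a ≠ p → b ≠ p → (0 < planeDet (f p) (f a) (f b) ↔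
      0 < planeDet (g p) (g (δ b)) (g (δ a)))) {a b c : J} (hab : a ≠ b) (hbc : b ≠ c)
    (hca : c ≠ a) :
    0 < planeDet (f a) (f b) (f c) ↔ 0 < planeDet (g (δ a)) (g (δ c)) (g (δ b)) := by
  by_cases ha : a = p
  · subst ha
    rw [hδ b c hab.symm hca, hδp]
  by_cases hb : b = p
  · subst hb
    rw [← planeDet_rotate, planeDet_rotate (g (δ b)) (g (δ a)), hδ c a hbc.symm hab, hδp]
  by_cases hc : c = p
  · subst hc
    rw [planeDet_rotate (f c), ← planeDet_rotate (g (δ a)), hδ a b hca.symm hbc, hδp]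
  have hne : ∀ x, x ≠ p → δ x ≠ p := fun x hx h => hx (δ.injective (h.trans hδp.symm))
  have h1 := hf.planeDet_pos_iff hp (a := ⟨a, ha⟩) (b := ⟨b, hb⟩) (c := ⟨c, hc⟩)
    (by simpa) (by simpa) (by simpa)
  have h2 := hg.planeDet_pos_iff hp (a := ⟨δ a, hne a ha⟩) (b := ⟨δ c, hne c hc⟩)
    (c := ⟨δ b, hne b hb⟩) (by simpa using hca.symm) (by simpa using hbc.symm)
    (by simpa using hab.symm)
  simp only [edgeAround, hδ a b ha hb, hδ b c hb hc, hδ c a hc ha] at h1 h2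
  rw [h1, h2]
  tauto

theorem _root_.orientationSign_eq (x y z : Plane) :
    orientationSign x y z = if 0 < planeDet x y z then 1 else -1 := rfl

/-- Two realizations of a geometry without inner points other than `p` have the same order type or opposite
order types, up to a relabelling. -/
theorem orientationMap_eq_or_neg [Finite J] (hf : G.IsRealization f) (hg : G.IsRealization g)
    (hp : ∀ x, x ≠ p → x ∈ G.outsideLayer) :
    ∃ δ : Equiv.Perm J,
      (∀ e : Triples J, orientationMap f e = orientationMap g (e.trans δ.toEmbedding)) ∨
      (∀ e : Triples J, orientationMap f e = -orientationMap g (e.trans δ.toEmbedding)) := by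
  classical
  have hR := edgeAround_isLocallyTransitiveTournament hf.generalPosition p
  have hS := edgeAround_isLocallyTransitiveTournament hg.generalPosition p
  obtain ⟨σ, hσ⟩ := hR.exists_equiv_or_reverse hS (hf.sameTriangles hg)
  have hδp : Equiv.Perm.ofSubtype σ p = p :=
    Equiv.Perm.ofSubtype_apply_of_not_mem σ (not_not.2 rfl)
  have hδ : ∀ a (ha : a ≠ p), Equiv.Perm.ofSubtype σ a = σ ⟨a, ha⟩ := fun a ha =>
    Equiv.Perm.ofSubtype_apply_of_mem σ ha
  refine ⟨Equiv.Perm.ofSubtype σ, hσ.imp (fun hσ e => ?_) (fun hσ e => ?_)⟩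
  · have h := hf.planeDet_pos_iff_of_iso hg hp hδp (fun a b ha hb => by
      rw [hδ a ha, hδ b hb]
      exact hσ ⟨a, ha⟩ ⟨b, hb⟩) (a := e 0) (b := e 1) (c := e 2)
      (e.injective.ne (by decide)) (e.injective.ne (by decide)) (e.injective.ne (by decide))
    simp only [orientationMap, orientationSign_eq, h]
    rfl
  · have h := hf.planeDet_pos_iff_of_reverse hg hp hδp (fun a b ha hb => by
      rw [hδ a ha, hδ b hb]
      exact hσ ⟨a, ha⟩ ⟨b, hb⟩) (a := e 0) (b := e 1) (c := e 2)
      (e.injective.ne (by decide)) (e.injective.ne (by decide)) (e.injective.ne (by decide))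
    rw [planeDet_swap (g _), neg_pos] at h
    -- `orientationSign` is `-1` on degenerate triples too, so swapping two points negates it only
    -- if the determinant is nonzero.
    have hne := hg.generalPosition.planeDet_ne_zero (a := Equiv.Perm.ofSubtype σ (e 0))
      (b := Equiv.Perm.ofSubtype σ (e 1)) (c := Equiv.Perm.ofSubtype σ (e 2))
      (by simp) (by simp) (by simp)
    simp only [orientationMap, orientationSign_eq, h, Function.Embedding.trans_apply,
      Equiv.toEmbedding_apply]
    rcases hne.lt_or_gt with h0 | h0
    · rw [if_pos h0, if_neg h0.not_gt, neg_neg]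
    · rw [if_neg h0.not_gt, if_pos h0]

end ConvexGeometry.IsRealization

/-! ### Counting the classes -/

/-- If any two members of a set of order types are equal or opposite up to a relabelling, they
lie in at most two classes. -/
theorem PlanarOrderType.encard_classes_le_two {J : Type*} (T : Set (PlanarOrderType J))
    (hT : ∀ t ∈ T, ∀ t' ∈ T, ∃ δ : Equiv.Perm J,
      (∀ e : Triples J, t.1 e = t'.1 (e.trans δ.toEmbedding)) ∨
      (∀ e : Triples J, t.1 e = -t'.1 (e.trans δ.toEmbedding))) :
    (Quotient.mk (PlanarOrderType.setoid J) '' T).encard ≤ 2 := by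
  rcases T.eq_empty_or_nonempty with rfl | ⟨t₀, ht₀⟩
  · simp
  suffices ∃ A B, Quotient.mk (PlanarOrderType.setoid J) '' T ⊆ {A, B} by
    obtain ⟨A, B, hAB⟩ := this
    exact (Set.encard_le_encard hAB).trans ((Set.encard_insert_le {B} A).trans (by rw [Set.encard_singleton]; rfl))
  have same : ∀ {t t' : PlanarOrderType J} {δ : Equiv.Perm J},
      (∀ e : Triples J, t.1 e = t'.1 (e.trans δ.toEmbedding)) →
      Quotient.mk (PlanarOrderType.setoid J) t = Quotient.mk _ t' := fun {t t' δ} h =>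
    (Quotient.sound (s := PlanarOrderType.setoid J) (a := t') (b := t) ⟨δ, h⟩).symm
  -- Two order types opposite to `t₀` are equivalent to each other, so one such `t₁` represents the
  -- second class; if there is none, `t₀` represents the only class.
  by_cases h : ∃ t₁ ∈ T, ∃ ε : Equiv.Perm J,
      ∀ e : Triples J, t₁.1 e = -t₀.1 (e.trans ε.toEmbedding)
  · obtain ⟨t₁, -, ε, hε⟩ := h
    refine ⟨Quotient.mk _ t₀, Quotient.mk _ t₁, ?_⟩
    rintro _ ⟨t, ht, rfl⟩
    obtain ⟨δ, hδ | hδ⟩ := hT t ht t₀ ht₀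
    · exact Or.inl (same hδ)
    · refine Or.inr (same (δ := δ.trans ε.symm) fun e => ?_)
      have he : e.trans δ.toEmbedding =
          (e.trans (δ.trans ε.symm).toEmbedding).trans ε.toEmbedding := by
        ext i
        simp
      rw [hδ, hε, he]
  · refine ⟨Quotient.mk _ t₀, Quotient.mk _ t₀, ?_⟩
    rintro _ ⟨t, ht, rfl⟩
    obtain ⟨δ, hδ | hδ⟩ := hT t ht t₀ ht₀
    · exact Or.inl (same hδ)
    · exact absurd ⟨t, ht, δ, hδ⟩ h

theorem mainTheorem10 {J : Type*} [Finite J] (G : ConvexGeometry J)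
    (h_four : G.IsFourGeometry) (h_realizable : G.IsRealizable)
    (h_inner : ∃ p : J, Set.univ \ G.outsideLayer = {p}) :
    G.orderTypeClasses.encard ≤ 2 := by
  obtain ⟨p, hp⟩ := h_inner
  have hp' : ∀ x, x ≠ p → x ∈ G.outsideLayer := fun x hx => by
    by_contra h
    exact hx (hp.subset ⟨trivial, h⟩)
  refine PlanarOrderType.encard_classes_le_two _ ?_
  rintro t ⟨f, hf, ht⟩ t' ⟨g, hg, ht'⟩
  rw [ht, ht']
  exact hf.orientationMap_eq_or_neg hg hp'
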